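/- Let $0<\epsilon<1$ and $r>0$ be constants, and let $\mathbb{G}=\mathbb{G}(n,p_2,p_3)$ be the random hypergraph on $n$ vertices in which each pair of vertices is a 2-edge with probability $p_2=\frac{1-\epsilon}{n}$ and each triple of vertices is a 3-edge with probability $p_3=\frac{r}{n\ln n}$, all independently ($n$ large enough that $p_3\le 1$). For a vertex $v$, the propagation process from $v$ starts with $v$ active and no inactive vertex; at each step $t=0,1,2,\dots$ some active vertex $v_t$ is picked, every unexplored vertex $u$ such that $\{v_t,u\}$ is a 2-edge, or $\{v_t,u,w\}$ is a 3-edge for some inactive $w$, becomes active, and $v_t$ becomes inactive; the process terminates when no active vertex is left. Let $C_v$ be the component of $v$: the set of all vertices that can be marked when $v$ is marked at the beginning and a vertex may be marked as soon as all other vertices of some edge containing it are marked. Put $$\lambda(x)=1-\epsilon+rx,\quad \lambda_1(x)=1-\epsilon+\tfrac r2x,\quad K_0=\max\{1,\lambda_1^{-1}(10)\},\quad I_{\epsilon,r}=\int_0^{\epsilon/r}\bigl[1-\lambda(\omega)+\ln\lambda(\omega)\bigr]\,d\omega .$$ Then there is a sequence $\delta_n\to0$, depending only on $\epsilon$ and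 $r$, such that for all sufficiently large $n$ and every vertex $v$ (hence also for a uniformly random vertex $v$), $$\mathbf{Pr}\bigl[|C_v|\ge K_0\ln n\bigr]\ \ge\ n^{I_{\epsilon,r}-\delta_n},$$ and likewise the probability that the propagation process from $v$ survives at least $K_0\ln n$ steps (whichever active vertices are picked) is at least $n^{I_{\epsilon,r}-\delta_n}$. -/

import Mathlib

open Filter Topology MeasureTheory

namespace Propagation

/-! ### The constants -/

/-- `λ(x) = 1 - ε + r x`. -/
noncomputable def lam (ε r x : ℝ) : ℝ := 1 - ε + r * x

/-- `λ₁(x) = 1 - ε + (r / 2) x`. -/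
noncomputable def lamOne (ε r x : ℝ) : ℝ := 1 - ε + r / 2 * x

/-- The inverse function `λ₁⁻¹` of `λ₁` (see `lamOne_eq_iff`). -/
noncomputable def lamOneInv (ε r y : ℝ) : ℝ := 2 * (y - (1 - ε)) / r

theorem lamOne_eq_iff {ε r : ℝ} (hr : 0 < r) (x y : ℝ) :
    lamOne ε r x = y ↔ x = lamOneInv ε r y := by
  unfold lamOne lamOneInv
  rw [eq_div_iff hr.ne']
  constructor <;> intro h <;> linarith

/-- `K₀ = max {1, λ₁⁻¹(10)}`. -/
noncomputable def K₀ (ε r : ℝ) : ℝ := max 1 (lamOneInv ε r 10)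

/-- `I_{ε,r} = ∫₀^{ε/r} [1 - λ(ω) + ln λ(ω)] dω`. -/
noncomputable def rateI (ε r : ℝ) : ℝ :=
  ∫ ω in (0 : ℝ)..(ε / r), (1 - lam ε r ω + Real.log (lam ε r ω))

/-! ### The random hypergraph -/

/-- The hypergraph on the whole of `V` whose edges are those of the two families `ω.1` and `ω.2`. -/
def hypergraphOf {V : Type*} (ω : Set (Set V) × Set (Set V)) : Hypergraph V where
  vertexSet := Set.univ
  edgeSet := ω.1 ∪ ω.2
  subset_vertexSet_of_mem_edgeSet' := fun _ _ => Set.subset_univ _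

/-- The law of the edges of `𝔾(V, p₂, p₃)`: each 2-element subset of `V` is put into the first
family with probability `p₂`, each 3-element subset of `V` is put into the second family with
probability `p₃`, all of them independently; no other sets occur. The random hypergraph itself is
`hypergraphOf ω` for `ω` with this law. -/
noncomputable def edgeLaw (V : Type*) (p₂ p₃ : unitInterval) :
    Measure (Set (Set V) × Set (Set V)) :=
  (ProbabilityTheory.setBernoulli {e : Set V | e.ncard = 2} p₂).prod
    (ProbabilityTheory.setBernoulli {e : Set V | e.ncard = 3} p₃)

/-! ### Propagation -/

/-- `Reached H v u`: the vertex `u` can be marked when `v` is marked at the beginning and a vertex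
may be marked as soon as all other vertices of some edge containing it are marked. -/
inductive Reached {V : Type*} (H : Hypergraph V) (v : V) : V → Prop
  | start : Reached H v v
  | step (e : Set V) (u : V) (he : e ∈ H.edgeSet) (hu : u ∈ e)
      (h : ∀ w ∈ e, w ≠ u → Reached H v w) : Reached H v u

/-- The component `C_v` of all vertices that are propagation connected from `v`. -/
def component {V : Type*} (H : Hypergraph V) (v : V) : Set V := {u | Reached H v u}

/-- The vertices that become active when the active vertex `x` is processed, `Y` being the set of
active and `D` the set of inactive vertices: the unexplored `u` that are joined to `x` by a 2-edge,
or to `x` and some inactive vertex by a 3-edge. -/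
def newlyActive {V : Type*} (H : Hypergraph V) (Y D : Set V) (x : V) : Set V :=
  {u | u ∉ Y ∧ u ∉ D ∧
    (({x, u} : Set V) ∈ H.edgeSet ∨ ∃ w ∈ D, ({x, u, w} : Set V) ∈ H.edgeSet)}

/-- `(Y t, D t)`, `t = 0, 1, 2, …`, are the sets of active and of inactive vertices of a propagation
process started at `v`. The active vertex to be processed may be picked by any rule. Once there is
no active vertex, the process has terminated and is constant. -/
structure IsProcess {V : Type*} (H : Hypergraph V) (v : V) (Y D : ℕ → Set V) : Prop where
  active_zero : Y 0 = {v}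
  inactive_zero : D 0 = ∅
  step : ∀ t, (Y t).Nonempty → ∃ x ∈ Y t,
    Y (t + 1) = (Y t ∪ newlyActive H (Y t) (D t) x) \ {x} ∧ D (t + 1) = D t ∪ {x}
  terminated : ∀ t, Y t = ∅ → Y (t + 1) = ∅ ∧ D (t + 1) = D t

/-- Every propagation process started at `v` survives at least `s` steps: if `T` is the first time
at which there is no active vertex, then `s ≤ T`. -/
def Survives {V : Type*} (H : Hypergraph V) (v : V) (s : ℝ) : Prop :=
  ∀ Y D : ℕ → Set V, IsProcess H v Y D → ∀ t : ℕ, (t : ℝ) < s → (Y t).Nonempty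

end Propagation

/-! When `t` vertices are inactive, a given unexplored vertex is activated with probability at least
`1 - (1 - p₂)(1 - p₃)^t`, roughly `λ(t / ln n) / n`, and every edge tested at this step is new. So
the number of active vertices dominates a walk with increments `Bin(N, q_t) - 1`, where `n - N` is
only of order `(ln n)²` or less (`survProb_le_edgeLaw_surv`).

Cut time into blocks of `m ≈ h ln n` steps and lower the success probability within block `i` to a
constant `l / (n + 1)`, with `l = min {1, λ(h i)}`. By the cycle lemma
(`binWeight_le_mul_walkProb`), a walk started at 1 stays positive through a block with probability
at least `P(Bin(mN, q) = m) / m`, which is `exp (m (1 - l + ln l))` up to a factor polynomial in `m`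
(`le_walkProb`). By monotonicity each block may be restarted from a single active vertex, so the
blocks multiply (`prod_walkProb_le_survProb`).

The exponents add up to `ln n` times a Riemann sum for `I_{ε,r}` (`rateI_le_sum`); boundedly many
polylogarithmic factors cost `n^{o(1)}`. Beyond `ε / r` the truncated rate is zero, so any constant
multiple of `ln n` can be reached, in particular `K₀ ln n`. A surviving run marks that many vertices
of the component; conversely a large component forces every run to survive
(`survives_of_le_ncard_component`). -/

namespace Propagation

/-! ### Binomial expectations -/

/-- The expectation of `g (X)` for a binomial random variable `X` with parameters `N` and `q`. -/
noncomputable def binExp (q : ℝ) : ℕ → (ℕ → ℝ) → ℝ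
  | 0, g => g 0
  | N + 1, g => (1 - q) * binExp q N g + q * binExp q N fun j => g (j + 1)

theorem binExp_mono {q : ℝ} (h0 : 0 ≤ q) (h1 : q ≤ 1) (N : ℕ) {f g : ℕ → ℝ}
    (h : ∀ j, f j ≤ g j) : binExp q N f ≤ binExp q N g := by
  induction N generalizing f g with
  | zero => exact h 0
  | succ N ih =>
    exact add_le_add (mul_le_mul_of_nonneg_left (ih h) (by linarith))
      (mul_le_mul_of_nonneg_left (ih fun j => h (j + 1)) h0)

theorem binExp_const (q : ℝ) (N : ℕ) (c : ℝ) : binExp q N (fun _ => c) = c := by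
  induction N with
  | zero => rfl
  | succ N ih => simp only [binExp, ih]; ring

theorem binExp_mul_const (q : ℝ) (N : ℕ) (g : ℕ → ℝ) (c : ℝ) :
    binExp q N (fun j => g j * c) = binExp q N g * c := by
  induction N generalizing g with
  | zero => rfl
  | succ N ih => simp only [binExp]; rw [ih, ih fun j => g (j + 1)]; ring

theorem binExp_nonneg {q : ℝ} (h0 : 0 ≤ q) (h1 : q ≤ 1) (N : ℕ) {g : ℕ → ℝ}
    (h : ∀ j, 0 ≤ g j) : 0 ≤ binExp q N g := by
  simpa [binExp_const] using binExp_mono h0 h1 N h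

theorem binExp_le_succ {q : ℝ} (h0 : 0 ≤ q) (h1 : q ≤ 1) (N : ℕ) {g : ℕ → ℝ} (hg : Monotone g) :
    binExp q N g ≤ binExp q (N + 1) g := by
  have := binExp_mono h0 h1 N fun j => hg (Nat.le_succ j)
  have := mul_le_mul_of_nonneg_left this h0
  simp only [binExp]
  simp only [Nat.succ_eq_add_one] at this
  linarith

theorem binExp_mono_left {q : ℝ} (h0 : 0 ≤ q) (h1 : q ≤ 1) {M N : ℕ} (h : M ≤ N) {g : ℕ → ℝ}
    (hg : Monotone g) : binExp q M g ≤ binExp q N g :=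
  monotone_nat_of_le_succ (f := fun N => binExp q N g) (fun N => binExp_le_succ h0 h1 N hg) h

theorem binExp_mono_prob {q p : ℝ} (h0 : 0 ≤ q) (hqp : q ≤ p) (h1 : p ≤ 1) (N : ℕ) {g : ℕ → ℝ}
    (hg : Monotone g) : binExp q N g ≤ binExp p N g := by
  induction N generalizing g with
  | zero => rfl
  | succ N ih =>
    have hg' : Monotone fun j => g (j + 1) := fun i j h => hg (by omega)
    have h2 : binExp p N g ≤ binExp p N fun j => g (j + 1) :=
      binExp_mono (h0.trans hqp) h1 N fun j => hg (Nat.le_succ j)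
    have h3 := mul_le_mul_of_nonneg_left (ih hg) (by linarith : 0 ≤ 1 - q)
    have h4 := mul_le_mul_of_nonneg_left (ih hg') h0
    have h5 := mul_nonneg (sub_nonneg.2 hqp) (sub_nonneg.2 h2)
    simp only [binExp]
    linarith

theorem binExp_add (q : ℝ) (M N : ℕ) (g : ℕ → ℝ) :
    binExp q (M + N) g = binExp q M fun i => binExp q N fun j => g (i + j) := by
  induction M generalizing g with
  | zero => simp [binExp]
  | succ M ih =>
    rw [Nat.succ_add]
    simp only [binExp]
    rw [ih, ih fun j => g (j + 1)]
    simp only [add_right_comm]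

/-- The binomial weights. -/
noncomputable def binWeight (q : ℝ) (N j : ℕ) : ℝ := N.choose j * q ^ j * (1 - q) ^ (N - j)

theorem binWeight_nonneg {q : ℝ} (h0 : 0 ≤ q) (h1 : q ≤ 1) (N j : ℕ) : 0 ≤ binWeight q N j := by
  have : 0 ≤ 1 - q := by linarith
  unfold binWeight
  positivity

theorem binExp_eq_sum (q : ℝ) (N : ℕ) (g : ℕ → ℝ) :
    binExp q N g = ∑ j ∈ Finset.range (N + 1), binWeight q N j * g j := by
  induction N generalizing g with
  | zero => simp [binExp, binWeight]
  | succ N ih =>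
    simp only [binExp]
    rw [ih, ih fun j => g (j + 1), Finset.sum_range_succ' _ (N + 1), Finset.mul_sum,
      Finset.mul_sum, Finset.sum_range_succ' _ N, Finset.sum_range_succ _ N]
    have key : ∀ j ∈ Finset.range N, binWeight q (N + 1) (j + 1) * g (j + 1) =
        (1 - q) * (binWeight q N (j + 1) * g (j + 1)) + q * (binWeight q N j * g (j + 1)) := by
      intro j hj
      have hj := Finset.mem_range.1 hj
      obtain ⟨k, rfl⟩ : ∃ k, N = j + 1 + k := ⟨N - (j + 1), by omega⟩
      simp only [binWeight, Nat.choose_succ_succ, Nat.succ_eq_add_one]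
      rw [show j + 1 + k + 1 - (j + 1) = k + 1 by omega, show j + 1 + k - (j + 1) = k by omega,
        show j + 1 + k - j = k + 1 by omega]
      push_cast
      ring
    rw [Finset.sum_range_succ (fun j => binWeight q (N + 1) (j + 1) * g (j + 1)) N,
      Finset.sum_congr rfl key, Finset.sum_add_distrib]
    simp only [binWeight, Nat.choose_zero_right, Nat.choose_self, Nat.sub_self, Nat.sub_zero,
      pow_zero, pow_succ]
    push_cast
    ring

/-! ### Walks with binomial increments -/

/-- The probability that a walk with binomial increments `X - 1`, started at `a`, is positive at
all times `0, …, m`. -/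
noncomputable def walkProb (N : ℕ) (q : ℝ) : ℕ → ℕ → ℝ
  | 0, a => if a = 0 then 0 else 1
  | m + 1, a => if a = 0 then 0 else binExp q N fun j => walkProb N q m (a - 1 + j)

/-- The probability that a walk with binomial increments `X - 1`, started at `a` at time `d`, with
success probability `q t` at time `t`, is positive at the times `d, …, d + k - 1`. -/
noncomputable def survProb (N : ℕ) (q : ℕ → ℝ) : ℕ → ℕ → ℕ → ℝ
  | 0, _, _ => 1
  | k + 1, a, d => if a = 0 then 0 else binExp (q d) N fun j => survProb N q k (a - 1 + j) (d + 1)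

section
variable {N : ℕ} {q : ℕ → ℝ}

theorem survProb_nonneg (h0 : ∀ t, 0 ≤ q t) (h1 : ∀ t, q t ≤ 1) (k a d : ℕ) :
    0 ≤ survProb N q k a d := by
  induction k generalizing a d with
  | zero => exact zero_le_one
  | succ k ih =>
    rw [survProb]
    split_ifs
    · rfl
    · exact binExp_nonneg (h0 d) (h1 d) N fun j => ih _ _

theorem survProb_le_one (h0 : ∀ t, 0 ≤ q t) (h1 : ∀ t, q t ≤ 1) (k a d : ℕ) :
    survProb N q k a d ≤ 1 := by
  induction k generalizing a d with
  | zero => rfl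
  | succ k ih =>
    rw [survProb]
    split_ifs
    · exact zero_le_one
    · exact (binExp_mono (h0 d) (h1 d) N fun j => ih _ _).trans (binExp_const _ _ _).le

theorem survProb_mono (h0 : ∀ t, 0 ≤ q t) (h1 : ∀ t, q t ≤ 1) (k d : ℕ) :
    Monotone fun a => survProb N q k a d := by
  induction k generalizing d with
  | zero => exact fun _ _ _ => le_rfl
  | succ k ih =>
    intro a b hab
    by_cases ha : a = 0
    · simpa [ha, survProb] using survProb_nonneg (N := N) h0 h1 (k + 1) b d
    · have hb : b ≠ 0 := by omega
      simp only [survProb, ha, hb, if_false]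
      exact binExp_mono (h0 d) (h1 d) N fun j => ih (d + 1) (by omega)

/-- The gluing step: a walk positive after `m` steps is at 1 or higher, and survival is monotone
both in the position and in the success probabilities. -/
theorem walkProb_mul_survProb_le (h0 : ∀ t, 0 ≤ q t) (h1 : ∀ t, q t ≤ 1) {p : ℝ} (hp : 0 ≤ p)
    (m k a d : ℕ) (hpq : ∀ i < m, p ≤ q (d + i)) :
    walkProb N p m a * survProb N q k 1 (d + m) ≤ survProb N q (m + k) a d := by
  induction m generalizing a d with
  | zero =>
    rw [walkProb]
    split_ifs with ha
    · simpa using survProb_nonneg h0 h1 _ _ _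
    · simpa using survProb_mono (N := N) h0 h1 k d (Nat.one_le_iff_ne_zero.2 ha)
  | succ m ih =>
    by_cases ha : a = 0
    · simpa [walkProb, ha] using survProb_nonneg h0 h1 _ _ _
    · rw [show m + 1 + k = m + k + 1 by omega]
      simp only [walkProb, survProb, ha, if_false]
      have hpd : p ≤ q d := hpq 0 (by omega)
      rw [← binExp_mul_const]
      refine (binExp_mono hp (hpd.trans (h1 d)) N fun j => ?_).trans
        (binExp_mono_prob hp hpd (h1 d) N ?_)
      · have := ih (a - 1 + j) (d + 1) fun i hi => by
          have := hpq (i + 1) (by omega)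
          rwa [show d + (i + 1) = d + 1 + i by omega] at this
        rwa [show d + 1 + m = d + (m + 1) by omega] at this
      · exact fun i j hij => survProb_mono (N := N) h0 h1 _ _ (by omega)

end

/-! ### Rotations -/

/-- An explicit sum over increment sequences, on which rotations can act. -/
theorem walkProb_eq_sum (N : ℕ) (q : ℝ) (m a : ℕ) :
    walkProb N q m a = ∑ x : Fin m → Fin (N + 1), (∏ i, binWeight q N (x i)) *
      if ∀ t ≤ m, t + 1 ≤ a + ∑ i : Fin m with i.val < t, (x i : ℕ) then 1 else 0 := by
  induction m generalizing a with
  | zero =>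
    simp only [walkProb, Finset.univ_unique, Finset.sum_singleton, Finset.univ_eq_empty]
    rcases Nat.eq_zero_or_pos a with ha | ha
    · simp [ha]
    · simp [ha.ne']
  | succ m ih =>
    rw [← (Fin.consEquiv fun _ => Fin (N + 1)).sum_comp, Fintype.sum_prod_type]
    simp only [Fin.consEquiv_apply, Fin.prod_univ_succ, Fin.cons_zero, Fin.cons_succ]
    have key : ∀ (j : Fin (N + 1)) (x : Fin m → Fin (N + 1)),
        (∀ t ≤ m + 1, t + 1 ≤ a + ∑ i : Fin (m + 1) with i.val < t,
          ((Fin.cons j x : Fin (m + 1) → Fin (N + 1)) i : ℕ)) ↔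
        a ≠ 0 ∧ ∀ t ≤ m, t + 1 ≤ a - 1 + j + ∑ i : Fin m with i.val < t, (x i : ℕ) := by
      intro j x
      have hs : ∀ t, ∑ i : Fin (m + 1) with i.val < t + 1,
          ((Fin.cons j x : Fin (m + 1) → Fin (N + 1)) i : ℕ) =
          j + ∑ i : Fin m with i.val < t, (x i : ℕ) := by
        intro t
        simp only [Finset.sum_filter, Fin.sum_univ_succ, Fin.cons_zero, Fin.cons_succ]
        simp
      constructor
      · intro h
        have ha := h 0 (by omega)
        simp only [Nat.not_lt_zero, Finset.filter_false, Finset.sum_empty] at ha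
        refine ⟨by omega, fun t ht => ?_⟩
        have := h (t + 1) (by omega)
        rw [hs] at this
        omega
      · rintro ⟨ha, h⟩ t ht
        rcases t with _ | t
        · simp; omega
        · have := h t (by omega)
          rw [hs]
          omega
    simp only [key]
    by_cases ha : a = 0
    · simp [walkProb, ha]
    · simp only [walkProb, ha, if_false, ne_eq, not_false_eq_true, true_and]
      rw [binExp_eq_sum, Finset.sum_range]
      refine Finset.sum_congr rfl fun j _ => ?_
      rw [ih, Finset.mul_sum]
      refine Finset.sum_congr rfl fun x _ => ?_
      rw [mul_assoc]

theorem binExp_mul_eq_sum (N : ℕ) (q : ℝ) (m : ℕ) (g : ℕ → ℝ) :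
    binExp q (m * N) g = ∑ x : Fin m → Fin (N + 1), (∏ i, binWeight q N (x i)) *
      g (∑ i, (x i : ℕ)) := by
  induction m generalizing g with
  | zero => simp [binExp]
  | succ m ih =>
    rw [← (Fin.consEquiv fun _ => Fin (N + 1)).sum_comp, Fintype.sum_prod_type,
      show (m + 1) * N = N + m * N by ring, binExp_add, binExp_eq_sum, Finset.sum_range]
    simp only [Fin.consEquiv_apply, Fin.prod_univ_succ, Fin.sum_univ_succ (n := m), Fin.cons_zero,
      Fin.cons_succ]
    refine Finset.sum_congr rfl fun j _ => ?_
    rw [ih, Finset.mul_sum]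
    exact Finset.sum_congr rfl fun x _ => (mul_assoc _ _ _).symm

/-- Some rotation of a sequence of length `m` and sum `m` has all partial sums of length `t` at
least `t`. -/
theorem exists_rotation {m : ℕ} [NeZero m] (x : Fin m → ℕ) (hx : ∑ i, x i = m) :
    ∃ k : Fin m, ∀ t ≤ m, t ≤ ∑ i : Fin m with i.val < t, x (i + k) := by
  have hm : 0 < m := Nat.pos_of_ne_zero (NeZero.ne m)
  let y : ℕ → ℕ := fun i => x (Fin.ofNat m i)
  let S : ℕ → ℤ := fun t => ∑ i ∈ Finset.range t, ((y i : ℤ) - 1)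
  have hper : ∀ i, y (i + m) = y i := fun i => by
    simp only [y]; congr 1; ext; simp
  have hSm : ∀ t, S (t + m) = S t := by
    intro t
    induction t with
    | zero =>
      simp only [S, Nat.zero_add, Finset.sum_range, Finset.sum_sub_distrib]
      have : ∑ i : Fin m, (y i : ℤ) = m := by
        have : ∑ i : Fin m, y i = m := (Finset.sum_congr rfl fun i _ =>
          congrArg x (Fin.ext (by simp))).trans hx
        exact_mod_cast this
      simp [this]
    | succ t ih =>
      rw [show t + 1 + m = t + m + 1 by omega]
      simp only [S, Finset.sum_range_succ] at ih ⊢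
      rw [ih, hper]
  -- Start where the partial sums of `x - 1` are smallest; by periodicity they never fall below that
  -- value later.
  obtain ⟨k, -, hk⟩ := Finset.exists_min_image Finset.univ (fun k : Fin m => S k)
    ⟨⟨0, hm⟩, Finset.mem_univ _⟩
  have hmin : ∀ t < 2 * m, S k ≤ S t := by
    intro t ht
    rcases lt_or_ge t m with h | h
    · exact hk ⟨t, h⟩ (Finset.mem_univ _)
    · obtain ⟨s, rfl⟩ := Nat.exists_eq_add_of_le' h
      rw [hSm]
      exact hk ⟨s, by omega⟩ (Finset.mem_univ _)
  refine ⟨k, fun t ht => ?_⟩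
  have hkt := hmin (k + t) (by have := k.isLt; omega)
  simp only [S, Finset.sum_range_add, Finset.sum_sub_distrib, Finset.sum_const,
    Finset.card_range, nsmul_eq_mul, mul_one] at hkt
  have hsum : ∑ i : Fin m with i.val < t, x (i + k) = ∑ i ∈ Finset.range t, y (k + i) := by
    refine Finset.sum_bij (fun i _ => i.val) (fun i hi => ?_) (fun i _ j _ h => Fin.ext h)
      (fun i hi => ?_) (fun i hi => ?_)
    · simpa using hi
    · have := Finset.mem_range.1 hi
      exact ⟨⟨i, by omega⟩, by simpa using this, rfl⟩
    · simp only [y]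
      congr 1
      ext
      simp [Fin.val_add, Nat.add_comm]
  rw [hsum]
  zify
  push_cast at hkt
  linarith

/-- The cycle lemma: each increment sequence with sum `m` has a good rotation, and the `m` rotations
preserve the product weight, so summing over them costs only a factor `m`. -/
theorem binWeight_le_mul_walkProb {N : ℕ} {q : ℝ} (h0 : 0 ≤ q) (h1 : q ≤ 1) {m : ℕ} (hm : 0 < m)
    (hN : 0 < N) : binWeight q (m * N) m ≤ m * walkProb N q m 1 := by
  have : NeZero m := ⟨hm.ne'⟩
  have e1 : binWeight q (m * N) m = binExp q (m * N) fun j => if j = m then 1 else 0 := by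
    rw [binExp_eq_sum, Finset.sum_eq_single m]
    · simp
    · intro j _ hj
      simp [hj]
    · intro h
      exact absurd (Finset.mem_range.2 (Nat.lt_succ_of_le (Nat.le_mul_of_pos_right m hN))) h
  rw [e1, binExp_mul_eq_sum, walkProb_eq_sum]
  set w : (Fin m → Fin (N + 1)) → ℝ := fun x => ∏ i, binWeight q N (x i) with hw
  set good : (Fin m → Fin (N + 1)) → ℝ := fun x =>
    if ∀ t ≤ m, t + 1 ≤ 1 + ∑ i : Fin m with i.val < t, (x i : ℕ) then 1 else 0 with hgood
  have hw0 : ∀ x, 0 ≤ w x := fun x => Finset.prod_nonneg fun i _ => binWeight_nonneg h0 h1 _ _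
  have hg0 : ∀ x, 0 ≤ good x := fun x => by simp only [hgood]; split_ifs <;> norm_num
  let rot : Fin m → (Fin m → Fin (N + 1)) ≃ (Fin m → Fin (N + 1)) := fun k =>
    (Equiv.addRight k).arrowCongr (Equiv.refl _) |>.symm
  have hrot : ∀ k x i, rot k x i = x (i + k) := fun k x i => rfl
  have hwrot : ∀ k x, w (rot k x) = w x := fun k x => by
    simp only [hw, hrot]
    exact Equiv.prod_comp (Equiv.addRight k) fun i => binWeight q N (x i)
  calc ∑ x, w x * (if ∑ i, (x i : ℕ) = m then 1 else 0)
      ≤ ∑ x, w x * ∑ k, good (rot k x) := by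
        refine Finset.sum_le_sum fun x _ => mul_le_mul_of_nonneg_left ?_ (hw0 x)
        split_ifs with h
        · obtain ⟨k, hk⟩ := exists_rotation (fun i => (x i : ℕ)) h
          refine le_trans ?_ (Finset.single_le_sum (f := fun k => good (rot k x))
            (fun k _ => hg0 _) (Finset.mem_univ k))
          simp only [hgood, hrot]
          rw [if_pos]
          intro t ht
          have := hk t ht
          omega
        · exact Finset.sum_nonneg fun k _ => hg0 _
    _ = ∑ k : Fin m, ∑ x, w x * good x := by
        simp only [Finset.mul_sum]
        rw [Finset.sum_comm]
        refine Finset.sum_congr rfl fun k _ => ?_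
        rw [← (rot k).sum_comp fun x => w x * good x]
        simp only [hwrot]
    _ = m * ∑ x, w x * good x := by simp

/-! ### Independence of events that depend on disjoint sets of edges -/

/-- The event `F` depends on the elements of `S` only. -/
def DependsOnly {ι : Type*} (S : Set ι) (F : Set (Set ι)) : Prop :=
  ∀ ω ω' : Set ι, (∀ i ∈ S, i ∈ ω ↔ i ∈ ω') → (ω ∈ F ↔ ω' ∈ F)

theorem setBernoulli_inter {ι : Type*} [Finite ι] (u : Set ι) (p : unitInterval) {S T : Set ι}
    (hST : Disjoint S T) {F G : Set (Set ι)} (hF : DependsOnly S F) (hG : DependsOnly T G) :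
    ProbabilityTheory.setBernoulli u p (F ∩ G) =
      ProbabilityTheory.setBernoulli u p F * ProbabilityTheory.setBernoulli u p G := by
  classical
  have := Fintype.ofFinite ι
  simp only [ProbabilityTheory.setBernoulli_apply']
  set P := Measure.infinitePi fun i : ι =>
    unitInterval.toNNReal p • Measure.dirac (i ∈ u) +
      unitInterval.toNNReal (unitInterval.symm p) • Measure.dirac False
  have hind : ProbabilityTheory.iIndepFun (fun (i : ι) (ω : ι → Prop) => ω i) P :=
    ProbabilityTheory.iIndepFun_infinitePi (X := fun i (x : Prop) => x) fun i => measurable_id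
  have h := hind.indepFun_finset S.toFinset T.toFinset
    (Set.disjoint_toFinset.2 hST) fun i => measurable_pi_apply i
  -- An event depending on `S` only is the preimage of its own image under restriction to `S`;
  -- independence of the two restrictions then applies.
  have key : ∀ {S : Set ι} {F : Set (Set ι)}, DependsOnly S F →
      (fun q : ι → Prop => {i | q i}) ⁻¹' F =
        (fun (ω : ι → Prop) (i : S.toFinset) => ω i) ⁻¹'
          ((fun (ω : ι → Prop) (i : S.toFinset) => ω i) ''
            ((fun q : ι → Prop => {i | q i}) ⁻¹' F)) := by
    intro S F hF
    refine subset_antisymm (Set.subset_preimage_image _ _) ?_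
    rintro ω ⟨ω', hω', he⟩
    refine (hF _ _ fun i hi => ?_).1 hω'
    have := congrFun he ⟨i, Set.mem_toFinset.2 hi⟩
    exact this.to_iff
  rw [Set.preimage_inter, key hF, key hG]
  exact h.measure_inter_preimage_eq_mul _ _ .of_discrete .of_discrete

theorem setBernoulli_forall_notMem {ι : Type*} [Finite ι] {u : Set ι} (p : unitInterval)
    (A : Finset ι) (hA : ∀ i ∈ A, i ∈ u) :
    (ProbabilityTheory.setBernoulli u p).real {ω | ∀ i ∈ A, i ∉ ω} = (1 - p : ℝ) ^ A.card := by
  have : (ProbabilityTheory.setBernoulli u p) {ω | ∀ i ∈ A, i ∉ ω} =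
      ∏ i ∈ A, (unitInterval.toNNReal (unitInterval.symm p) : ENNReal) := by
    rw [ProbabilityTheory.setBernoulli_apply',
      show (fun q : ι → Prop => {i | q i}) ⁻¹' {ω | ∀ i ∈ A, i ∉ ω} =
        (A : Set ι).pi fun _ => {False} by ext; simp,
      Measure.infinitePi_pi _ fun _ _ => .of_discrete]
    refine Finset.prod_congr rfl fun i hi => ?_
    simp [hA i hi]
  rw [measureReal_def, this]
  simp

variable {V : Type*}

/-- The event `F` depends only on whether the elements of `S` are edges. -/
def EdgeLocal (S : Set (Set V)) (F : Set (Set (Set V) × Set (Set V))) : Prop :=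
  ∀ ω ω' : Set (Set V) × Set (Set V),
    (∀ e ∈ S, (e ∈ ω.1 ↔ e ∈ ω'.1) ∧ (e ∈ ω.2 ↔ e ∈ ω'.2)) → (ω ∈ F ↔ ω' ∈ F)

theorem EdgeLocal.compl {S : Set (Set V)} {F : Set (Set (Set V) × Set (Set V))}
    (hF : EdgeLocal S F) : EdgeLocal S Fᶜ :=
  fun ω ω' hω => not_congr (hF ω ω' hω)

instance (p₂ p₃ : unitInterval) : IsProbabilityMeasure (edgeLaw V p₂ p₃) := by
  unfold edgeLaw; infer_instance

/-- Fubini: for a fixed first family the slices are independent, and their measures, as functions of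
the first family, again depend on disjoint sets of edges. -/
theorem edgeLaw_inter [Finite V] (p₂ p₃ : unitInterval) {S T : Set (Set V)} (hST : Disjoint S T)
    {F G : Set (Set (Set V) × Set (Set V))} (hF : EdgeLocal S F) (hG : EdgeLocal T G) :
    (edgeLaw V p₂ p₃).real (F ∩ G) = (edgeLaw V p₂ p₃).real F * (edgeLaw V p₂ p₃).real G := by
  classical
  suffices h : edgeLaw V p₂ p₃ (F ∩ G) = edgeLaw V p₂ p₃ F * edgeLaw V p₂ p₃ G by
    simp only [measureReal_def, h, ENNReal.toReal_mul]
  simp only [edgeLaw]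
  set μ := ProbabilityTheory.setBernoulli {e : Set V | e.ncard = 2} p₂ with hμ
  set ν := ProbabilityTheory.setBernoulli {e : Set V | e.ncard = 3} p₃ with hν
  have hslice : ∀ {S : Set (Set V)} {F : Set (Set (Set V) × Set (Set V))}, EdgeLocal S F →
      ∀ x, DependsOnly S (Prod.mk x ⁻¹' F) := fun hF x ω ω' h =>
    hF (x, ω) (x, ω') fun e he => ⟨Iff.rfl, h e he⟩
  have hfun : ∀ {S : Set (Set V)} {F : Set (Set (Set V) × Set (Set V))}, EdgeLocal S F →
      ∀ s, DependsOnly S ((fun x => ν (Prod.mk x ⁻¹' F)) ⁻¹' s) := by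
    intro S F hF s ω ω' h
    have : Prod.mk ω ⁻¹' F = Prod.mk ω' ⁻¹' F :=
      Set.ext fun x => hF (ω, x) (ω', x) fun e he => ⟨h e he, Iff.rfl⟩
    simp only [Set.mem_preimage, this]
  rw [Measure.prod_apply .of_discrete, Measure.prod_apply .of_discrete,
    Measure.prod_apply .of_discrete]
  simp only [Set.preimage_inter]
  rw [lintegral_congr fun x => setBernoulli_inter _ p₃ hST (hslice hF x) (hslice hG x)]
  refine ProbabilityTheory.lintegral_mul_eq_lintegral_mul_lintegral_of_indepFun
    (Measurable.of_discrete (f := fun x => ν (Prod.mk x ⁻¹' F)))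
    (Measurable.of_discrete (f := fun x => ν (Prod.mk x ⁻¹' G))) ?_
  rw [ProbabilityTheory.indepFun_iff_measure_inter_preimage_eq_mul]
  intro s t _ _
  exact setBernoulli_inter _ p₂ hST (hfun hF s) (hfun hG t)

/-! ### Exposing the edges vertex by vertex -/

-- The events `E u` are the independent trials of one step and `F A` is the future once `A` is the
-- set of successes. Since the future looks only at `T`, exposing the trials one by one leaves its
-- probability unchanged.
open Classical in
theorem binExp_le_edgeLaw [Finite V] (p₂ p₃ : unitInterval) {q : ℝ} (h0 : 0 ≤ q) (h1 : q ≤ 1)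
    (E : V → Set (Set (Set V) × Set (Set V))) (S : V → Set (Set V)) (T : Set (Set V))
    (U : Finset V) (hE : ∀ u ∈ U, EdgeLocal (S u) (E u))
    (hq : ∀ u ∈ U, q ≤ (edgeLaw V p₂ p₃).real (E u))
    (hS : ∀ u ∈ U, ∀ u' ∈ U, u ≠ u' → Disjoint (S u) (S u')) (hT : ∀ u ∈ U, Disjoint (S u) T)
    (F : Finset V → Set (Set (Set V) × Set (Set V))) (hF : ∀ A ⊆ U, EdgeLocal T (F A))
    {g : ℕ → ℝ} (hg : Monotone g) (hFg : ∀ A ⊆ U, g A.card ≤ (edgeLaw V p₂ p₃).real (F A)) :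
    binExp q U.card g ≤
      (edgeLaw V p₂ p₃).real {ω | ω ∈ F {u ∈ U | ω ∈ E u}} := by
  induction U using Finset.induction_on generalizing F g with
  | empty => simpa [binExp] using hFg ∅ le_rfl
  | insert v U hv ih =>
    have hsub : U ⊆ insert v U := Finset.subset_insert _ _
    have hvm : v ∈ insert v U := Finset.mem_insert_self _ _
    have ih' := @ih (fun u hu => hE u (hsub hu)) (fun u hu => hq u (hsub hu))
      (fun u hu u' hu' => hS u (hsub hu) u' (hsub hu')) (fun u hu => hT u (hsub hu))
    set F₁ : Finset V → Set (Set (Set V) × Set (Set V)) := fun A => F (insert v A) with hF₁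
    have hins : ∀ A ⊆ U, insert v A ⊆ insert v U := fun A hA => Finset.insert_subset_insert v hA
    have a0 := ih' F (fun A hA => hF A (hA.trans hsub)) hg fun A hA => hFg A (hA.trans hsub)
    have a1 := ih' F₁ (fun A hA => hF _ (hins A hA)) (g := fun j => g (j + 1))
      (fun i j h => hg (by omega)) fun A hA => by
        have := hFg _ (hins A hA)
        rwa [Finset.card_insert_of_notMem fun h => hv (hA h)] at this
    have hloc : ∀ F : Finset V → Set (Set (Set V) × Set (Set V)),
        (∀ A ⊆ U, EdgeLocal T (F A)) →
        EdgeLocal (T ∪ ⋃ u ∈ U, S u) {ω | ω ∈ F {u ∈ U | ω ∈ E u}} := by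
      intro F hF ω ω' h
      have : ({u ∈ U | ω ∈ E u} : Finset V) = {u ∈ U | ω' ∈ E u} :=
        Finset.filter_congr fun u hu => hE u (hsub hu) ω ω' fun e he =>
          h e (Or.inr (Set.mem_biUnion hu he))
      simp only [Set.mem_ofPred_eq, this]
      exact hF _ (Finset.filter_subset _ _) ω ω' fun e he => h e (Or.inl he)
    have hdis : Disjoint (S v) (T ∪ ⋃ u ∈ U, S u) := by
      rw [Set.disjoint_union_right, Set.disjoint_iUnion₂_right]
      exact ⟨hT v hvm, fun u hu => hS v hvm u (hsub hu) fun h => hv (h ▸ hu)⟩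
    set Q₀ := {ω | ω ∈ F {u ∈ U | ω ∈ E u}} with hQ₀
    set Q₁ := {ω | ω ∈ F₁ {u ∈ U | ω ∈ E u}} with hQ₁
    have m0 := edgeLaw_inter p₂ p₃ hdis (hE v hvm).compl
      (hloc F fun A hA => hF A (hA.trans hsub))
    have m1 := edgeLaw_inter p₂ p₃ hdis (hE v hvm) (hloc F₁ fun A hA => hF _ (hins A hA))
    have hsplit : {ω | ω ∈ F {u ∈ insert v U | ω ∈ E u}} = ((E v)ᶜ ∩ Q₀) ∪ (E v ∩ Q₁) := by
      ext ω
      by_cases hω : ω ∈ E v <;> simp [hω, hQ₀, hQ₁, hF₁, Finset.filter_insert]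
    have hd : Disjoint ((E v)ᶜ ∩ Q₀) (E v ∩ Q₁) :=
      Set.disjoint_left.2 fun ω h h' => h.1 h'.1
    rw [hsplit, measureReal_union hd .of_discrete, m0, m1, Finset.card_insert_of_notMem hv,
      probReal_compl_eq_one_sub .of_discrete]
    have hpq := hq v hvm
    have hp1 : (edgeLaw V p₂ p₃).real (E v) ≤ 1 := measureReal_le_one
    set p := (edgeLaw V p₂ p₃).real (E v)
    -- A one-trial binomial stands for `E v`, so its probability may be lowered from `p` to `q`.
    refine (binExp_mono_prob h0 hpq hp1 1 (g := fun j => binExp q U.card fun i => g (i + j))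
      fun i j hij => binExp_mono h0 h1 _ fun k => hg (by omega)).trans' ?_ |>.trans ?_
    · simp [binExp]
    · simp only [binExp]
      have := mul_le_mul_of_nonneg_left a0 (sub_nonneg.2 hp1)
      have := mul_le_mul_of_nonneg_left a1 (h0.trans hpq)
      simp only [add_zero]
      simp only [zero_add] at *
      linarith

/-! ### Survival of the process with a fixed rule for picking active vertices -/

section
variable {V : Type*}

/-- The event that `u` is joined to `x` by a 2-edge, or to `x` and a vertex of `D` by a 3-edge. -/
def joined (D : Finset V) (x u : V) : Set (Set (Set V) × Set (Set V)) :=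
  {ω | ({x, u} : Set V) ∈ (hypergraphOf ω).edgeSet ∨
    ∃ w ∈ D, ({x, u, w} : Set V) ∈ (hypergraphOf ω).edgeSet}

theorem joined_edgeLocal {S : Set (Set V)} {D : Finset V} {x u : V} (h2 : ({x, u} : Set V) ∈ S)
    (h3 : ∀ w ∈ D, ({x, u, w} : Set V) ∈ S) : EdgeLocal S (joined D x u) := by
  intro ω ω' h
  have h' : ∀ e ∈ S, e ∈ (hypergraphOf ω).edgeSet ↔ e ∈ (hypergraphOf ω').edgeSet := fun e he =>
    or_congr (h e he).1 (h e he).2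
  exact or_congr (h' _ h2) (exists_congr fun w => and_congr_right fun hw => h' _ (h3 w hw))

/-- If `u` is not joined to `x`, then one pair and `D.card` distinct triples are all absent. -/
theorem le_edgeLaw_joined [Finite V] (p₂ p₃ : unitInterval) (D : Finset V) {x u : V} (hxu : x ≠ u)
    (hx : x ∉ D) (hu : u ∉ D) :
    1 - (1 - p₂ : ℝ) * (1 - p₃ : ℝ) ^ D.card ≤ (edgeLaw V p₂ p₃).real (joined D x u) := by
  classical
  set A : Finset (Set V) := D.image fun w => ({x, u, w} : Set V) with hA
  have hinj : Set.InjOn (fun w => ({x, u, w} : Set V)) D := by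
    intro w hw w' hw' h
    have : w ∈ ({x, u, w'} : Set V) := by
      have h : ({x, u, w} : Set V) = {x, u, w'} := h
      rw [← h]; simp
    rcases this with rfl | rfl | h
    · exact absurd hw hx
    · exact absurd hw hu
    · exact h
  have hcard : A.card = D.card := Finset.card_image_of_injOn hinj
  have h2 := setBernoulli_forall_notMem (u := {e : Set V | e.ncard = 2}) p₂ {({x, u} : Set V)}
    fun e he => by
      rw [Finset.mem_singleton.1 he]
      exact Set.ncard_pair hxu
  have h3 := setBernoulli_forall_notMem (u := {e : Set V | e.ncard = 3}) p₃ A fun e he => by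
    obtain ⟨w, hw, rfl⟩ := Finset.mem_image.1 he
    exact Set.ncard_eq_three.2 ⟨x, u, w, hxu, fun h => hx (h ▸ hw), fun h => hu (h ▸ hw), rfl⟩
  have hprod := measureReal_prod_prod
    (μ := ProbabilityTheory.setBernoulli {e : Set V | e.ncard = 2} p₂)
    (ν := ProbabilityTheory.setBernoulli {e : Set V | e.ncard = 3} p₃)
    {ω | ∀ i ∈ ({({x, u} : Set V)} : Finset (Set V)), i ∉ ω} {ω | ∀ i ∈ A, i ∉ ω}
  rw [h2, h3, hcard, Finset.card_singleton, pow_one] at hprod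
  rw [← hprod]
  have hsub : (joined D x u)ᶜ ⊆ {ω | ∀ i ∈ ({({x, u} : Set V)} : Finset (Set V)), i ∉ ω} ×ˢ
      {ω | ∀ i ∈ A, i ∉ ω} := by
    intro ω hω
    refine ⟨fun i hi h => hω (Or.inl (Or.inl ?_)), fun i hi h => hω (Or.inr ?_)⟩
    · rwa [← Finset.mem_singleton.1 hi]
    · obtain ⟨w, hw, rfl⟩ := Finset.mem_image.1 hi
      exact ⟨w, hw, Or.inr h⟩
  have := measureReal_mono (μ := edgeLaw V p₂ p₃) hsub
  rw [probReal_compl_eq_one_sub .of_discrete] at this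
  unfold edgeLaw at this ⊢
  linarith

variable [Fintype V]

open Classical in
/-- The event that the process with the active vertices `Y` and the inactive vertices `D`, and with
some fixed rule for picking active vertices, survives at least `k` more steps. -/
noncomputable def surv : ℕ → Finset V → Finset V → Set (Set (Set V) × Set (Set V))
  | 0, _, _ => Set.univ
  | k + 1, Y, D =>
    if h : Y.Nonempty then
      {ω | ω ∈ surv k ((Y ∪ {u ∈ (Y ∪ D)ᶜ | ω ∈ joined D h.choose u}).erase h.choose)
        (insert h.choose D)}
    else ∅

/-- Each edge tested from now on contains the picked vertex and its target, neither of them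
inactive. An edge tested earlier has at most one vertex that is still not inactive, so it never
recurs. -/
theorem surv_edgeLocal (k : ℕ) (Y D : Finset V) (hYD : Disjoint Y D) :
    EdgeLocal {e : Set V | ∃ a ∈ e, ∃ b ∈ e, a ≠ b ∧ a ∉ D ∧ b ∉ D} (surv k Y D) := by
  classical
  induction k generalizing Y D with
  | zero => exact fun _ _ _ => Iff.rfl
  | succ k ih =>
    rw [surv]
    split_ifs with hY
    · set x := hY.choose
      have hx : x ∈ Y := hY.choose_spec
      have hxD : x ∉ D := Finset.disjoint_left.1 hYD hx
      intro ω ω' h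
      have hnew : ({u ∈ (Y ∪ D)ᶜ | ω ∈ joined D x u} : Finset V) =
          {u ∈ (Y ∪ D)ᶜ | ω' ∈ joined D x u} := by
        refine Finset.filter_congr fun u hu => ?_
        simp only [Finset.mem_compl, Finset.mem_union, not_or] at hu
        have hxu : x ≠ u := fun h => hu.1 (h ▸ hx)
        exact joined_edgeLocal
          (S := {e | ∃ a ∈ e, ∃ b ∈ e, a ≠ b ∧ a ∉ D ∧ b ∉ D}) ⟨x, by simp, u, by simp, hxu, hxD, hu.2⟩
          (fun w _ => ⟨x, by simp, u, by simp, hxu, hxD, hu.2⟩) ω ω' h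
      simp only [Set.mem_ofPred_eq, hnew]
      refine ih _ _ ?_ ω ω' fun e he => h e ?_
      · rw [Finset.disjoint_left] at hYD ⊢
        intro a ha
        simp only [Finset.mem_erase, Finset.mem_union, Finset.mem_filter, Finset.mem_compl,
          Finset.mem_insert] at ha ⊢
        have := @hYD a
        tauto
      · obtain ⟨a, ha, b, hb, hab, haD, hbD⟩ := he
        exact ⟨a, ha, b, hb, hab, fun h => haD (Finset.mem_insert_of_mem h),
          fun h => hbD (Finset.mem_insert_of_mem h)⟩
    · exact fun _ _ _ => Iff.rfl

/-- A step uses up only one active vertex. This settles the case of many active vertices; otherwise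
at least `N` vertices remain unexplored. -/
theorem surv_eq_univ (k : ℕ) (Y D : Finset V) (h : k ≤ Y.card) : surv k Y D = Set.univ := by
  classical
  induction k generalizing Y D with
  | zero => rfl
  | succ k ih =>
    have hY : Y.Nonempty := Finset.card_pos.1 (by omega)
    rw [surv, dif_pos hY]
    refine Set.eq_univ_of_forall fun ω => ?_
    rw [Set.mem_ofPred_eq, ih]
    · trivial
    · rw [Finset.card_erase_of_mem (Finset.mem_union_left _ hY.choose_spec)]
      have := Finset.card_le_card (Finset.subset_union_left (s₁ := Y)
        (s₂ := {u ∈ (Y ∪ D)ᶜ | ω ∈ joined D hY.choose u}))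
      omega

theorem survProb_le_edgeLaw_surv (p₂ p₃ : unitInterval) {q : ℕ → ℝ} (h0 : ∀ t, 0 ≤ q t)
    (hq : ∀ t, q t ≤ 1 - (1 - p₂ : ℝ) * (1 - p₃ : ℝ) ^ t) {N K : ℕ}
    (hN : N + K ≤ Fintype.card V) (k : ℕ) (Y D : Finset V) (hYD : Disjoint Y D)
    (hk : k + D.card ≤ K) :
    survProb N q k Y.card D.card ≤ (edgeLaw V p₂ p₃).real (surv k Y D) := by
  classical
  have h1 : ∀ t, q t ≤ 1 := fun t => (hq t).trans (sub_le_self _ (mul_nonneg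
    (sub_nonneg.2 p₂.2.2) (pow_nonneg (sub_nonneg.2 p₃.2.2) t)))
  induction k generalizing Y D with
  | zero => simp [surv, survProb]
  | succ k ih =>
    rcases le_or_gt (k + 1) Y.card with hc | hc
    · rw [surv_eq_univ _ _ _ hc, probReal_univ]
      exact survProb_le_one h0 h1 _ _ _
    rw [survProb, surv]
    by_cases hY : Y.Nonempty
    · rw [if_neg (Finset.card_pos.2 hY).ne', dif_pos hY]
      set x := hY.choose
      have hx : x ∈ Y := hY.choose_spec
      have hxD : x ∉ D := Finset.disjoint_left.1 hYD hx
      set U : Finset V := (Y ∪ D)ᶜ with hU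
      have hmemU : ∀ u ∈ U, u ∉ Y ∧ u ∉ D := fun u hu => by
        simpa only [hU, Finset.mem_compl, Finset.mem_union, not_or] using hu
      have hUc : N ≤ U.card := by
        rw [hU, Finset.card_compl, Finset.card_union_of_disjoint hYD]
        omega
      have hmono : Monotone fun j => survProb N q k (Y.card - 1 + j) (D.card + 1) :=
        fun i j hij => survProb_mono h0 h1 _ _ (by omega)
      refine (binExp_mono_left (h0 _) (h1 _) hUc hmono).trans ?_
      -- The trial of `u` uses edges whose only vertex outside `insert x D` is `u`; the future uses
      -- edges with two such vertices.
      refine binExp_le_edgeLaw p₂ p₃ (h0 _) (h1 _) (fun u => joined D x u)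
        (fun u => {e | u ∈ e ∧ x ∈ e ∧ ∀ a ∈ e, a = x ∨ a = u ∨ a ∈ D})
        {e : Set V | ∃ a ∈ e, ∃ b ∈ e, a ≠ b ∧ a ∉ insert x D ∧ b ∉ insert x D} U
        ?_ ?_ ?_ ?_ (fun A => surv k ((Y ∪ A).erase x) (insert x D)) ?_ hmono ?_
      · intro u _
        refine joined_edgeLocal ⟨by simp, by simp, by simp⟩ fun w hw => ⟨by simp, by simp, ?_⟩
        rintro a (rfl | rfl | rfl) <;> simp [hw]
      · intro u hu
        have := hmemU u hu
        exact (hq _).trans (le_edgeLaw_joined p₂ p₃ D (fun h => this.1 (h ▸ hx)) hxD this.2)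
      · intro u hu u' hu' huu
        have := hmemU u hu
        refine Set.disjoint_left.2 fun e he he' => ?_
        rcases he'.2.2 u he.1 with h | h | h
        · exact this.1 (h ▸ hx)
        · exact huu h
        · exact this.2 h
      · intro u hu
        refine Set.disjoint_left.2 fun e he he' => ?_
        obtain ⟨a, ha, b, hb, hab, haD, hbD⟩ := he'
        simp only [Finset.mem_insert, not_or] at haD hbD
        have h1 := he.2.2 a ha
        have h2 := he.2.2 b hb
        have h1 : a = u := by tauto
        have h2 : b = u := by tauto
        exact hab (h1.trans h2.symm)
      all_goals
        intro A hA
        have hd : Disjoint ((Y ∪ A).erase x) (insert x D) := by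
          rw [Finset.disjoint_left] at hYD ⊢
          intro a ha
          simp only [Finset.mem_erase, Finset.mem_union, Finset.mem_insert] at ha ⊢
          have h1 := @hYD a
          have h2 := fun h : a ∈ A => hmemU a (hA h)
          tauto
      · exact surv_edgeLocal k _ _ hd
      · have hYA : Disjoint Y A :=
          Finset.disjoint_left.2 fun a ha ha' => (hmemU a (hA ha')).1 ha
        have hY1 := Finset.card_pos.2 hY
        have := ih _ _ hd (by rw [Finset.card_insert_of_notMem hxD]; omega)
        rw [Finset.card_insert_of_notMem hxD,
          Finset.card_erase_of_mem (Finset.mem_union_left _ hx),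
          Finset.card_union_of_disjoint hYA] at this
        rwa [show Y.card - 1 + A.card = Y.card + A.card - 1 by omega]
    · rw [if_pos (by simpa using Finset.not_nonempty_iff_eq_empty.1 hY)]
      exact measureReal_nonneg

/-! ### Survival and the size of the component -/

theorem le_ncard_component_of_mem_surv {ω : Set (Set V) × Set (Set V)} {v : V} (k : ℕ)
    (Y D : Finset V) (hYD : Disjoint Y D) (hY : ∀ u ∈ Y, u ∈ component (hypergraphOf ω) v)
    (hD : ∀ u ∈ D, u ∈ component (hypergraphOf ω) v) (h : ω ∈ surv k Y D) :
    k + D.card ≤ (component (hypergraphOf ω) v).ncard := by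
  classical
  induction k generalizing Y D with
  | zero =>
    rw [Nat.zero_add, ← Set.ncard_coe_finset]
    exact Set.ncard_le_ncard hD
  | succ k ih =>
    rw [surv] at h
    split_ifs at h with hne
    · set x := hne.choose
      have hx : x ∈ Y := hne.choose_spec
      have hxD : x ∉ D := Finset.disjoint_left.1 hYD hx
      have := ih _ _ ?_ ?_ ?_ h
      · rw [Finset.card_insert_of_notMem hxD] at this
        omega
      · rw [Finset.disjoint_left] at hYD ⊢
        intro a ha
        simp only [Finset.mem_erase, Finset.mem_union, Finset.mem_filter, Finset.mem_compl,
          Finset.mem_insert] at ha ⊢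
        have := @hYD a
        tauto
      · intro u hu
        rcases Finset.mem_union.1 (Finset.mem_of_mem_erase hu) with hu | hu
        · exact hY u hu
        · rcases (Finset.mem_filter.1 hu).2 with he | ⟨w, hw, he⟩
          · refine Reached.step _ u he (by simp) ?_
            rintro w (rfl | rfl) hne
            · exact hY _ hx
            · exact absurd rfl hne
          · refine Reached.step _ u he (by simp) ?_
            rintro a (rfl | rfl | rfl) hne
            · exact hY _ hx
            · exact absurd rfl hne
            · exact hD _ hw
      · intro u hu
        rcases Finset.mem_insert.1 hu with rfl | hu
        · exact hY _ hx
        · exact hD u hu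
    · exact absurd h (Set.notMem_empty _)

end

section
variable {V : Type*} {H : Hypergraph V} {v : V} {Y D : ℕ → Set V}

/-- When the last of the other vertices of `e` is processed, `u` becomes active unless it is already
explored. The bound on edge sizes matters: a one-vertex edge would mark `u` without any activation.
-/
theorem IsProcess.mem_of_edge (hP : IsProcess H v Y D)
    (hH : ∀ e ∈ H.edgeSet, e.ncard = 2 ∨ e.ncard = 3) (t : ℕ) {e : Set V} {u : V}
    (he : e ∈ H.edgeSet) (hu : u ∈ e) (h : ∀ w ∈ e, w ≠ u → w ∈ D t) : u ∈ Y t ∪ D t := by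
  induction t with
  | zero =>
    exfalso
    have h1 : e ⊆ {u} := fun w hw => by
      by_contra hne
      have := h w hw hne
      rw [hP.inactive_zero] at this
      exact this
    have := Set.ncard_le_ncard h1
    rw [Set.ncard_singleton] at this
    rcases hH e he with h | h <;> omega
  | succ t ih =>
    rcases Set.eq_empty_or_nonempty (Y t) with hY | hY
    · obtain ⟨h1, h2⟩ := hP.terminated t hY
      rw [h2] at h
      have := ih h
      rw [hY] at this
      rwa [h1, h2]
    obtain ⟨x, hx, hY', hD'⟩ := hP.step t hY
    rw [hD'] at h
    have hsub : Y t ∪ D t ⊆ Y (t + 1) ∪ D (t + 1) := by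
      rw [hY', hD']
      intro a ha
      by_cases hax : a = x
      · exact Or.inr (Or.inr hax)
      · rcases ha with ha | ha
        · exact Or.inl ⟨Or.inl ha, hax⟩
        · exact Or.inr (Or.inl ha)
    by_cases hut : u ∈ Y t ∪ D t
    · exact hsub hut
    have hux : u ≠ x := fun h => hut (Or.inl (h ▸ hx))
    have hxe : x ∈ e := by
      by_contra hxe
      refine hut (ih fun w hw hwu => (h w hw hwu).resolve_right ?_)
      rintro rfl
      exact hxe hw
    refine Or.inl ?_
    rw [hY']
    refine ⟨Or.inr ⟨fun h => hut (Or.inl h), fun h => hut (Or.inr h), ?_⟩, hux⟩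
    have hxu : ({x, u} : Set V).ncard = 2 := Set.ncard_pair hux.symm
    have hsube : ({x, u} : Set V) ⊆ e := Set.insert_subset hxe (Set.singleton_subset_iff.2 hu)
    have hfin : e.Finite := Set.finite_of_ncard_pos (by rcases hH e he with h | h <;> omega)
    rcases hH e he with hc | hc
    · left
      rwa [Set.eq_of_subset_of_ncard_le hsube (by omega) hfin]
    · right
      obtain ⟨w, hwe, hw⟩ := Set.exists_mem_notMem_of_ncard_lt_ncard
        (s := ({x, u} : Set V)) (t := e) (by omega)
      simp only [Set.mem_insert_iff, Set.mem_singleton_iff, not_or] at hw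
      refine ⟨w, (h w hwe hw.2).resolve_right hw.1, ?_⟩
      have hc3 : ({x, u, w} : Set V).ncard = 3 :=
        Set.ncard_eq_three.2 ⟨x, u, w, hux.symm, Ne.symm hw.1, Ne.symm hw.2, rfl⟩
      rwa [Set.eq_of_subset_of_ncard_le (t := e) (s := {x, u, w}) ?_ (by omega) hfin]
      exact Set.insert_subset hxe (Set.insert_subset hu (Set.singleton_subset_iff.2 hwe))

theorem IsProcess.start_mem (hP : IsProcess H v Y D) (t : ℕ) : v ∈ Y t ∪ D t := by
  induction t with
  | zero => rw [hP.active_zero]; exact Or.inl rfl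
  | succ t ih =>
    rcases Set.eq_empty_or_nonempty (Y t) with hY | hY
    · obtain ⟨h1, h2⟩ := hP.terminated t hY
      rw [hY] at ih
      rwa [h1, h2]
    obtain ⟨x, hx, hY', hD'⟩ := hP.step t hY
    rw [hY', hD']
    by_cases hvx : v = x
    · exact Or.inr (Or.inr hvx)
    · rcases ih with h | h
      · exact Or.inl ⟨Or.inl h, hvx⟩
      · exact Or.inr (Or.inl h)

theorem IsProcess.finite_ncard_le (hP : IsProcess H v Y D) (t : ℕ) :
    (D t).Finite ∧ (D t).ncard ≤ t := by
  induction t with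
  | zero => rw [hP.inactive_zero]; simp
  | succ t ih =>
    rcases Set.eq_empty_or_nonempty (Y t) with hY | hY
    · rw [(hP.terminated t hY).2]
      exact ⟨ih.1, by omega⟩
    obtain ⟨x, hx, hY', hD'⟩ := hP.step t hY
    rw [hD']
    refine ⟨ih.1.union (Set.finite_singleton x), (Set.ncard_union_le _ _).trans ?_⟩
    rw [Set.ncard_singleton]
    omega

/-- Once no vertex is active, the inactive set contains `v` and is closed under marking, hence
contains the component; but it has at most `t` elements. -/
theorem survives_of_le_ncard_component (hH : ∀ e ∈ H.edgeSet, e.ncard = 2 ∨ e.ncard = 3) {s : ℝ}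
    (hs : s ≤ (component H v).ncard) : Survives H v s := by
  intro Y D hP t ht
  by_contra hne
  have hY : Y t = ∅ := Set.not_nonempty_iff_eq_empty.1 hne
  have hsub : component H v ⊆ D t := by
    intro u hu
    induction hu with
    | start => simpa [hY] using hP.start_mem t
    | step e u he hu _ ih => simpa [hY] using hP.mem_of_edge hH t he hu ih
  obtain ⟨hfin, hcard⟩ := hP.finite_ncard_le t
  have := (Set.ncard_le_ncard hsub hfin).trans hcard
  have : ((component H v).ncard : ℝ) ≤ t := by exact_mod_cast this
  linarith

end

theorem edgeLaw_ae_ncard {V : Type*} [Finite V] (p₂ p₃ : unitInterval) :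
    ∀ᵐ ω ∂edgeLaw V p₂ p₃, ∀ e ∈ (hypergraphOf ω).edgeSet, e.ncard = 2 ∨ e.ncard = 3 := by
  have h2 := (Measure.quasiMeasurePreserving_fst
    (μ := ProbabilityTheory.setBernoulli {e : Set V | e.ncard = 2} p₂)
    (ν := ProbabilityTheory.setBernoulli {e : Set V | e.ncard = 3} p₃)).ae
    ProbabilityTheory.setBernoulli_ae_subset
  have h3 := (Measure.quasiMeasurePreserving_snd
    (μ := ProbabilityTheory.setBernoulli {e : Set V | e.ncard = 2} p₂)
    (ν := ProbabilityTheory.setBernoulli {e : Set V | e.ncard = 3} p₃)).ae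
    ProbabilityTheory.setBernoulli_ae_subset
  unfold edgeLaw
  filter_upwards [h2, h3] with ω h2 h3 e he
  exact he.imp (fun h => h2 h) fun h => h3 h

theorem edgeLaw_component_le_survives {V : Type*} [Finite V] (p₂ p₃ : unitInterval) (v : V)
    (s : ℝ) :
    (edgeLaw V p₂ p₃).real {ω | s ≤ ((component (hypergraphOf ω) v).ncard : ℝ)} ≤
      (edgeLaw V p₂ p₃).real {ω | Survives (hypergraphOf ω) v s} := by
  refine ENNReal.toReal_mono (measure_ne_top _ _) (measure_mono_ae ?_)
  filter_upwards [edgeLaw_ae_ncard p₂ p₃] with ω hω h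
  exact survives_of_le_ncard_component hω h

theorem survProb_le_edgeLaw_component {V : Type*} [Fintype V] (p₂ p₃ : unitInterval) {q : ℕ → ℝ}
    (h0 : ∀ t, 0 ≤ q t) (hq : ∀ t, q t ≤ 1 - (1 - p₂ : ℝ) * (1 - p₃ : ℝ) ^ t) {N K : ℕ}
    (hN : N + K ≤ Fintype.card V) (v : V) {s : ℝ} (hs : s ≤ K) :
    survProb N q K 1 0 ≤
      (edgeLaw V p₂ p₃).real {ω | s ≤ ((component (hypergraphOf ω) v).ncard : ℝ)} := by
  have h := survProb_le_edgeLaw_surv p₂ p₃ h0 hq hN K {v} ∅ (Finset.disjoint_empty_right _)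
    (by simp)
  rw [Finset.card_singleton, Finset.card_empty] at h
  refine h.trans (measureReal_mono fun ω hω => ?_)
  have := le_ncard_component_of_mem_surv (v := v) K {v} ∅ (Finset.disjoint_empty_right _)
    (fun u hu => by rw [Finset.mem_singleton.1 hu]; exact Reached.start) (by simp) hω
  rw [Finset.card_empty, Nat.add_zero] at this
  exact hs.trans (by exact_mod_cast this)

/-! ### Estimates -/

/-- Stirling's sequence decreases from its value at 1; the factor `√m` is weakened to `m`. -/
theorem factorial_mul_exp_le {m : ℕ} (hm : 0 < m) :
    (m.factorial : ℝ) * Real.exp m ≤ Real.exp 1 * m * (m : ℝ) ^ m := by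
  obtain ⟨k, rfl⟩ := Nat.exists_eq_add_of_le' hm
  have h := Stirling.stirlingSeq'_antitone (Nat.zero_le k)
  simp only [Function.comp_apply, Nat.succ_eq_add_one, Nat.zero_add, Stirling.stirlingSeq_one] at h
  generalize k + 1 = m at hm h ⊢
  have hm' : (1 : ℝ) ≤ m := by exact_mod_cast hm
  have h2 : (0 : ℝ) < √2 := by positivity
  have he : Real.exp m = Real.exp 1 ^ m := by rw [← Real.exp_nat_mul, mul_one]
  have hpos : (0 : ℝ) < √(2 * m) * (m / Real.exp 1) ^ m := by positivity
  rw [Stirling.stirlingSeq, div_le_div_iff₀ hpos h2, Real.sqrt_mul (by norm_num), div_pow] at h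
  have h3 : (m.factorial : ℝ) * Real.exp m ≤ Real.exp 1 * √m * (m : ℝ) ^ m := by
    rw [he]
    have h4 : (m.factorial : ℝ) ≤ Real.exp 1 * √m * ((m : ℝ) ^ m / Real.exp 1 ^ m) := by
      refine le_of_mul_le_mul_right (h.trans (le_of_eq ?_)) h2
      ring
    refine (mul_le_mul_of_nonneg_right h4 (by positivity)).trans (le_of_eq ?_)
    field_simp
  refine h3.trans ?_
  have : √(m : ℝ) ≤ m := Real.sqrt_le_iff.2 ⟨by linarith, by nlinarith⟩
  gcongr

/-- The denominator `n + 1` makes the bound exact: the base is at least `exp (-x)` with `x = l / (n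
+ 1 - l)`, and `N x ≤ l` because `N ≤ n ≤ n + 1 - l`. -/
theorem exp_neg_le_one_sub_pow {l : ℝ} (hl0 : 0 ≤ l) (hl1 : l ≤ 1) {n N : ℕ} (hN1 : 1 ≤ N)
    (hN : N ≤ n) : Real.exp (-l) ≤ (1 - l / (n + 1)) ^ N := by
  have hn1 : (1 : ℝ) ≤ n := by exact_mod_cast hN1.trans hN
  have hN' : (N : ℝ) ≤ n := by exact_mod_cast hN
  set x : ℝ := l / (n + 1 - l) with hx
  have hden : (0 : ℝ) < n + 1 - l := by linarith
  have hx0 : 0 ≤ x := by positivity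
  have h1 : 1 - l / (n + 1) = (1 + x)⁻¹ := by
    rw [hx]
    field_simp
    ring
  have h2 : Real.exp (-x) ≤ 1 - l / (n + 1) := by
    rw [h1, Real.exp_neg]
    exact inv_anti₀ (by linarith) (by linarith [Real.add_one_le_exp x])
  have h3 : N * x ≤ l := by
    rw [hx, ← mul_div_assoc, div_le_iff₀ hden]
    nlinarith
  calc Real.exp (-l) ≤ Real.exp (N * (-x)) := Real.exp_le_exp.2 (by linarith)
    _ = Real.exp (-x) ^ N := Real.exp_nat_mul _ _
    _ ≤ _ := pow_le_pow_left₀ (Real.exp_pos _).le h2 N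

/-- In the loss `2 e m²`, one `m` comes from the rotations, `e m` from Stirling, and 2 from
replacing `((N - 1) / (n + 1))^m` by `1 / 2`, where `hmN` enters through Bernoulli's inequality. -/
theorem le_walkProb {l : ℝ} (hl0 : 0 < l) (hl1 : l ≤ 1) {n N m : ℕ} (hm : 0 < m) (hN1 : 1 ≤ N)
    (hN : N ≤ n) (hmN : 2 * m * (n + 2 - N) ≤ n + 1) :
    Real.exp (m * (1 - l + Real.log l)) / (2 * Real.exp 1 * (m : ℝ) ^ 2) ≤
      walkProb N (l / (n + 1)) m 1 := by
  have hm' : (0 : ℝ) < m := by exact_mod_cast hm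
  have hn : (0 : ℝ) < (n : ℝ) + 1 := by positivity
  have hq0 : 0 ≤ l / (n + 1) := by positivity
  have hq1 : l / (n + 1) ≤ 1 := by
    rw [div_le_one hn]
    have : (0 : ℝ) ≤ n := Nat.cast_nonneg n
    linarith
  have hw := binWeight_le_mul_walkProb hq0 hq1 hm hN1
  have hchoose : ((m : ℝ) * (N - 1)) ^ m ≤ (m * N).choose m * m.factorial := by
    have h := Nat.pow_sub_le_descFactorial (m * N) m
    rw [Nat.descFactorial_eq_factorial_mul_choose] at h
    have h' : (m * (N - 1)) ^ m ≤ m.factorial * (m * N).choose m := by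
      refine (Nat.pow_le_pow_left ?_ m).trans h
      rw [Nat.mul_sub, mul_one]
      omega
    have h'' : (((m * (N - 1)) ^ m : ℕ) : ℝ) ≤ ((m.factorial * (m * N).choose m : ℕ) : ℝ) :=
      Nat.cast_le.2 h'
    push_cast [Nat.cast_sub hN1] at h''
    linarith
  have hhalf : l ^ m / 2 ≤ ((N : ℝ) - 1) ^ m * (l / (n + 1)) ^ m := by
    set y : ℝ := (n + 2 - N) / (n + 1) with hy
    have hsub : ((n + 2 - N : ℕ) : ℝ) = n + 2 - N := by
      rw [Nat.cast_sub (by omega)]; push_cast; ring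
    have hmN' : 2 * (m : ℝ) * (n + 2 - N) ≤ n + 1 := by
      rw [← hsub]; exact_mod_cast hmN
    have hmy : m * y ≤ 1 / 2 := by
      rw [hy, ← mul_div_assoc, div_le_iff₀ hn]
      linarith
    have hm1 : (1 : ℝ) ≤ m := by exact_mod_cast hm
    have hy0 : 0 ≤ y := by rw [hy, ← hsub]; positivity
    have hb := one_add_mul_le_pow (a := -y) (by nlinarith) m
    have e : ((N : ℝ) - 1) ^ m * (l / (n + 1)) ^ m = l ^ m * (1 + -y) ^ m := by
      rw [← mul_pow, ← mul_pow, hy]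
      congr 1
      field_simp
      ring
    rw [e, div_eq_mul_inv]
    exact mul_le_mul_of_nonneg_left (by linarith) (by positivity)
  have hpow : Real.exp (-l) ^ m ≤ (1 - l / (n + 1)) ^ (m * N - m) := by
    refine (pow_le_pow_left₀ (Real.exp_pos _).le
      (exp_neg_le_one_sub_pow hl0.le hl1 hN1 hN) m).trans ?_
    rw [← pow_mul, mul_comm N m]
    exact pow_le_pow_of_le_one (by linarith) (by linarith) (Nat.sub_le _ _)
  have hfac : (0 : ℝ) < m.factorial := by exact_mod_cast m.factorial_pos
  have hbin : (m : ℝ) ^ m / m.factorial * (l ^ m / 2) * Real.exp (-l) ^ m ≤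
      binWeight (l / (n + 1)) (m * N) m := by
    unfold binWeight
    refine mul_le_mul ?_ hpow (by positivity) (by positivity)
    rw [div_mul_eq_mul_div, div_le_iff₀ hfac]
    calc (m : ℝ) ^ m * (l ^ m / 2)
        ≤ (m : ℝ) ^ m * (((N : ℝ) - 1) ^ m * (l / (n + 1)) ^ m) := by gcongr
      _ = ((m : ℝ) * (N - 1)) ^ m * (l / (n + 1)) ^ m := by rw [mul_pow]; ring
      _ ≤ (m * N).choose m * m.factorial * (l / (n + 1)) ^ m := by gcongr
      _ = _ := by ring
  have hst : Real.exp m / (Real.exp 1 * m) ≤ (m : ℝ) ^ m / m.factorial := by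
    rw [div_le_div_iff₀ (by positivity) hfac]
    linarith [factorial_mul_exp_le hm]
  have hexp : Real.exp (m * (1 - l + Real.log l)) = Real.exp m * l ^ m * Real.exp (-l) ^ m := by
    rw [show m * (1 - l + Real.log l) = m + m * Real.log l + m * (-l) by ring, Real.exp_add,
      Real.exp_add, Real.exp_nat_mul, Real.exp_nat_mul, Real.exp_log hl0]
  have : Real.exp m / (Real.exp 1 * m) * (l ^ m / 2) * Real.exp (-l) ^ m ≤
      m * walkProb N (l / (n + 1)) m 1 := by
    refine le_trans ?_ (hbin.trans hw)
    gcongr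
  rw [hexp, div_le_iff₀ (by positivity)]
  rw [div_mul_eq_mul_div, div_mul_eq_mul_div, div_le_iff₀ (by positivity)] at this
  linarith

theorem walkProb_nonneg {q : ℝ} (h0 : 0 ≤ q) (h1 : q ≤ 1) (N m a : ℕ) : 0 ≤ walkProb N q m a := by
  rw [walkProb_eq_sum]
  refine Finset.sum_nonneg fun x _ => mul_nonneg
    (Finset.prod_nonneg fun i _ => binWeight_nonneg h0 h1 _ _) ?_
  split_ifs <;> norm_num

theorem prod_walkProb_le_survProb {Q : ℕ → ℝ} (h0 : ∀ i, 0 ≤ Q i) (h1 : ∀ i, Q i ≤ 1) (N : ℕ)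
    {m : ℕ} (hm : 0 < m) (M j : ℕ) :
    ∏ i ∈ Finset.range M, walkProb N (Q (j + i)) m 1 ≤
      survProb N (fun t => Q (t / m)) (M * m) 1 (j * m) := by
  induction M generalizing j with
  | zero => simp [survProb]
  | succ M ih =>
    rw [Finset.prod_range_succ', mul_comm, Nat.succ_mul, Nat.add_comm (M * m), Nat.add_zero]
    refine le_trans ?_ (walkProb_mul_survProb_le (fun t => h0 _) (fun t => h1 _) (h0 j) m (M * m) 1
      (j * m) fun i hi => ?_)
    · refine mul_le_mul_of_nonneg_left ?_ (walkProb_nonneg (h0 j) (h1 j) _ _ _)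
      have := ih (j + 1)
      rw [Nat.succ_mul] at this
      simpa only [Nat.add_assoc, Nat.add_comm 1] using this
    · rw [show (j * m + i) / m = j by
        rw [Nat.mul_comm, Nat.mul_add_div hm, Nat.div_eq_of_lt hi, Nat.add_zero]]

/-- The failure probability is at most `exp (-l / n) ≤ 1 / (1 + l / n) = 1 - l / (n + l)`, and `l ≤
1`. -/
theorem div_le_one_sub_mul_pow {l a b : ℝ} (hl0 : 0 ≤ l) (hl1 : l ≤ 1) {n t : ℕ} (hn : 0 < n)
    (hb : b ≤ 1) (h : l / n ≤ a + t * b) :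
    l / (n + 1) ≤ 1 - (1 - a) * (1 - b) ^ t := by
  have hn' : (0 : ℝ) < n := by exact_mod_cast hn
  have h1 : (1 - a) * (1 - b) ^ t ≤ Real.exp (-(l / n)) := by
    calc (1 - a) * (1 - b) ^ t ≤ Real.exp (-a) * Real.exp (-b) ^ t := by
          refine mul_le_mul (by linarith [Real.add_one_le_exp (-a)])
            (pow_le_pow_left₀ (by linarith) (by linarith [Real.add_one_le_exp (-b)]) t)
            (pow_nonneg (by linarith) t) (Real.exp_pos _).le
      _ = Real.exp (-a + t * (-b)) := by rw [Real.exp_add, Real.exp_nat_mul]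
      _ ≤ _ := Real.exp_le_exp.2 (by linarith)
  have h2 : Real.exp (-(l / n)) ≤ (1 + l / n)⁻¹ := by
    rw [Real.exp_neg]
    exact inv_anti₀ (by positivity) (by linarith [Real.add_one_le_exp (l / n)])
  have h3 : (1 + l / n)⁻¹ = 1 - l / (n + l) := by
    field_simp
    ring
  have h4 : l / (n + 1) ≤ l / (n + l) := by gcongr
  linarith

/-! ### The rate function -/

/-- `1 - l + ln l` for `l = min {1, λ(x)}`. -/
noncomputable def truncRate (ε r x : ℝ) : ℝ :=
  1 - min 1 (lam ε r x) + Real.log (min 1 (lam ε r x))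

theorem one_sub_add_log_mono {a b : ℝ} (ha : 0 < a) (hab : a ≤ b) (hb : b ≤ 1) :
    1 - a + Real.log a ≤ 1 - b + Real.log b := by
  have hb0 : 0 < b := ha.trans_le hab
  have h := Real.log_le_sub_one_of_pos (div_pos ha hb0)
  rw [Real.log_div ha.ne' hb0.ne'] at h
  have : a / b - 1 ≤ a - b := by
    rw [div_sub_one hb0.ne', div_le_iff₀ hb0]
    nlinarith
  linarith

theorem min_lam_pos {ε r : ℝ} (hε₁ : ε < 1) (hr : 0 < r) {x : ℝ} (hx : 0 ≤ x) : 0 < min 1 (lam ε r x) := by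
  have : 0 ≤ r * x := by positivity
  exact lt_min one_pos (by unfold lam; linarith)

theorem truncRate_monotoneOn {ε r : ℝ} (hε₁ : ε < 1) (hr : 0 < r) :
    MonotoneOn (truncRate ε r) (Set.Ici 0) := by
  intro x hx y _ hxy
  refine one_sub_add_log_mono (min_lam_pos hε₁ hr hx) ?_ (min_le_left _ _)
  refine min_le_min_left _ ?_
  unfold lam
  gcongr

theorem truncRate_nonpos {ε r : ℝ} (hε₁ : ε < 1) (hr : 0 < r) {x : ℝ} (hx : 0 ≤ x) :
    truncRate ε r x ≤ 0 := by
  have := Real.log_le_sub_one_of_pos (min_lam_pos hε₁ hr hx)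
  unfold truncRate
  linarith

theorem truncRate_eq_zero {ε r : ℝ} (hr : 0 < r) {x : ℝ} (hx : ε / r ≤ x) :
    truncRate ε r x = 0 := by
  have : 1 ≤ lam ε r x := by
    rw [div_le_iff₀ hr] at hx
    unfold lam
    linarith
  simp [truncRate, min_eq_left this]

theorem rateI_eq {ε r : ℝ} (hε₀ : 0 < ε) (hr : 0 < r) :
    rateI ε r = ∫ x in (0 : ℝ)..(ε / r), truncRate ε r x := by
  refine intervalIntegral.integral_congr fun x hx => ?_
  rw [Set.uIcc_of_le (by positivity)] at hx
  have : lam ε r x ≤ 1 := by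
    have := hx.2
    rw [le_div_iff₀ hr] at this
    unfold lam
    linarith
  simp only [truncRate, min_eq_right this]

/-- The rate is increasing, so the right Riemann sum bounds the integral; the left sum differs from
it only by the two end terms, and the one at `ε / r` vanishes. -/
theorem rateI_le_sum {ε r : ℝ} (hε₀ : 0 < ε) (hε₁ : ε < 1) (hr : 0 < r) {M : ℕ} (hM : 0 < M) :
    rateI ε r + ε / r / M * truncRate ε r 0 ≤
      ε / r / M * ∑ i ∈ Finset.range M, truncRate ε r (ε / r / M * i) := by
  have hM' : (0 : ℝ) < M := by exact_mod_cast hM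
  set h : ℝ := ε / r / M with hh
  have hh0 : 0 < h := by positivity
  have hhM : h * M = ε / r := by rw [hh]; field_simp
  have hmono : MonotoneOn (fun x => truncRate ε r (h * x)) (Set.Icc 0 (0 + (M : ℝ))) :=
    fun x hx y hy hxy => truncRate_monotoneOn hε₁ hr (mul_nonneg hh0.le hx.1)
      (mul_nonneg hh0.le hy.1) (mul_le_mul_of_nonneg_left hxy hh0.le)
  have h1 := hmono.integral_le_sum
  rw [intervalIntegral.integral_comp_mul_left _ hh0.ne', zero_add, hhM, mul_zero,
    ← rateI_eq hε₀ hr, smul_eq_mul, inv_mul_le_iff₀ hh0] at h1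
  have h2 := Finset.sum_range_succ' (fun i : ℕ => truncRate ε r (h * i)) M
  rw [Finset.sum_range_succ, hhM, truncRate_eq_zero hr le_rfl, Nat.cast_zero, mul_zero,
    add_zero] at h2
  rw [h2, mul_add]
  simpa using h1

/-! ### The lower bound -/

theorem eventually_polynomial_le_exp (P : Polynomial ℝ) {C : ℝ} (hC : 0 < C) :
    ∀ᶠ x : ℝ in atTop, P.eval x ≤ C * Real.exp x := by
  filter_upwards [(Polynomial.tendsto_div_exp_atTop P).eventually (gt_mem_nhds hC)] with x hx
  rw [div_lt_iff₀ (Real.exp_pos x)] at hx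
  exact hx.le

theorem exists_seq_tendsto_zero {P : ℕ → ℝ → Prop} (hmono : ∀ n a b, a ≤ b → P n a → P n b)
    (h : ∀ η > 0, ∀ᶠ n in atTop, P n η) :
    ∃ δ : ℕ → ℝ, Tendsto δ atTop (𝓝 0) ∧ ∀ᶠ n in atTop, P n (δ n) := by
  let S : ℕ → Set ℝ := fun n => {η | 0 < η ∧ P n η}
  have hbdd : ∀ n, BddBelow (S n) := fun n => ⟨0, fun η hη => hη.1.le⟩
  have hS0 : ∀ n, 0 ≤ sInf (S n) := fun n => Real.sInf_nonneg fun η hη => hη.1.le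
  -- The infimum of the admissible exponents need not be admissible, hence the extra `1 / (n + 1)`.
  refine ⟨fun n => sInf (S n) + 1 / ((n : ℝ) + 1), ?_, ?_⟩
  · have h1 : Tendsto (fun n => sInf (S n)) atTop (𝓝 0) := by
      refine tendsto_order.2 ⟨fun a ha => .of_forall fun n => ha.trans_le (hS0 n), fun a ha => ?_⟩
      filter_upwards [h (a / 2) (by linarith)] with n hn
      exact (csInf_le (hbdd n) ⟨by linarith, hn⟩).trans_lt (by linarith)
    simpa using h1.add tendsto_one_div_add_atTop_nhds_zero_nat
  · filter_upwards [h 1 one_pos] with n hn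
    obtain ⟨η, hη, hlt⟩ := exists_lt_of_csInf_lt (s := S n) ⟨1, one_pos, hn⟩
      (lt_add_of_pos_right (sInf (S n)) (by positivity : (0 : ℝ) < 1 / ((n : ℝ) + 1)))
    exact hmono n _ _ hlt.le hη.2

theorem prod_le_edgeLaw_component {ε r h : ℝ} (hε₁ : ε < 1) (hr : 0 < r) (hh : 0 < h) {n M m : ℕ}
    (hm : 0 < m) (hL : 0 < Real.log n) (hhm : h * Real.log n ≤ m) (hn : M * m + 1 ≤ n)
    (hmn : 2 * m * (M * m + 2) ≤ n + 1) {p₂ p₃ : unitInterval} (hp₂ : (p₂ : ℝ) = (1 - ε) / n)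
    (hp₃ : (p₃ : ℝ) = r / (n * Real.log n)) (v : Fin n) {s : ℝ} (hs : s ≤ M * m) :
    ∏ i ∈ Finset.range M, (Real.exp (m * truncRate ε r (h * i)) /
        (2 * Real.exp 1 * (m : ℝ) ^ 2)) ≤
      (edgeLaw (Fin n) p₂ p₃).real {ω | s ≤ ((component (hypergraphOf ω) v).ncard : ℝ)} := by
  have hn0 : 0 < n := by omega
  have hn0' : (0 : ℝ) < n := by exact_mod_cast hn0
  have hm' : (0 : ℝ) < m := by exact_mod_cast hm
  set l : ℕ → ℝ := fun i => min 1 (lam ε r (h * i)) with hl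
  have hl0 : ∀ i, 0 < l i := fun i => min_lam_pos hε₁ hr (by positivity)
  have hl1 : ∀ i, l i ≤ 1 := fun i => min_le_left _ _
  have hQ0 : ∀ i, 0 ≤ l i / (n + 1) := fun i => div_nonneg (hl0 i).le (by positivity)
  have hQ1 : ∀ i, l i / (n + 1) ≤ 1 := fun i => by
    rw [div_le_one (by positivity)]
    linarith [hl1 i]
  have hq : ∀ t, l (t / m) / (n + 1) ≤ 1 - (1 - p₂ : ℝ) * (1 - p₃ : ℝ) ^ t := by
    intro t
    refine div_le_one_sub_mul_pow (hl0 _).le (hl1 _) hn0 p₃.2.2 ?_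
    have h1 : (p₂ : ℝ) + t * p₃ = lam ε r (t / Real.log n) / n := by
      rw [hp₂, hp₃]
      unfold lam
      field_simp
    rw [h1]
    refine div_le_div_of_nonneg_right ((min_le_right _ _).trans ?_) hn0'.le
    -- Rounding time down to the start of its block only lowers `λ`.
    have h2 : h * (t / m : ℕ) ≤ t / Real.log n := by
      rw [le_div_iff₀ hL]
      have h3 : ((t / m : ℕ) : ℝ) * m ≤ t := by exact_mod_cast Nat.div_mul_le_self t m
      have h4 : (0 : ℝ) ≤ (t / m : ℕ) := Nat.cast_nonneg _
      calc h * (t / m : ℕ) * Real.log n = (t / m : ℕ) * (h * Real.log n) := by ring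
        _ ≤ (t / m : ℕ) * m := mul_le_mul_of_nonneg_left hhm h4
        _ ≤ t := h3
    unfold lam
    gcongr
  have hsurv := survProb_le_edgeLaw_component (N := n - M * m) (K := M * m) p₂ p₃
    (fun t => hQ0 (t / m)) hq (by rw [Fintype.card_fin]; omega) v (s := s) (by push_cast; exact hs)
  have hprod := prod_walkProb_le_survProb hQ0 hQ1 (n - M * m) hm M 0
  rw [Nat.zero_mul] at hprod
  refine le_trans ?_ (hprod.trans hsurv)
  refine Finset.prod_le_prod (fun i _ => by positivity) fun i _ => ?_
  rw [Nat.zero_add]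
  refine le_walkProb (hl0 i) (hl1 i) hm (by omega) (by omega) ?_
  rwa [show n + 2 - (n - M * m) = M * m + 2 by omega]

theorem eventually_rpow_le_edgeLaw_component {ε r : ℝ} (hε₀ : 0 < ε) (hε₁ : ε < 1) (hr : 0 < r)
    (κ : ℝ) {η : ℝ} (hη : 0 < η) :
    ∀ᶠ n : ℕ in atTop, ∀ p₂ p₃ : unitInterval,
      (p₂ : ℝ) = (1 - ε) / n → (p₃ : ℝ) = r / (n * Real.log n) → ∀ v : Fin n,
        (n : ℝ) ^ (rateI ε r - η) ≤ (edgeLaw (Fin n) p₂ p₃).real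
          {ω | κ * Real.log n ≤ ((component (hypergraphOf ω) v).ncard : ℝ)} := by
  -- With `M₀` blocks up to `ε / r`, the Riemann sum error is at most `η / 2`.
  obtain ⟨M₀, hM₀⟩ := exists_nat_gt (ε / r * (-truncRate ε r 0) / (η / 2))
  have hR0 := truncRate_nonpos hε₁ hr (x := 0) le_rfl
  have hM₀pos : (0 : ℝ) < M₀ := lt_of_le_of_lt
    (div_nonneg (mul_nonneg (by positivity) (by linarith)) (by positivity)) hM₀
  set h : ℝ := ε / r / M₀ with hh
  have hh0 : 0 < h := by positivity
  have hhR : -(η / 2) ≤ h * truncRate ε r 0 := by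
    rw [div_lt_iff₀ (by positivity)] at hM₀
    have : ε / r * (-truncRate ε r 0) / M₀ ≤ η / 2 := by
      rw [div_le_iff₀ hM₀pos]
      linarith
    have e : h * truncRate ε r 0 = -(ε / r * (-truncRate ε r 0) / M₀) := by rw [hh]; ring
    linarith
  -- Enough blocks to reach `κ ln n`; those from `M₀` on have rate zero.
  obtain ⟨M₁, hM₁⟩ := exists_nat_ge (κ / h)
  set M := max M₀ M₁ with hM
  set S : ℝ := ∑ i ∈ Finset.range M, truncRate ε r (h * i) with hS
  have hS0 : S ≤ 0 := Finset.sum_nonpos fun i _ => truncRate_nonpos hε₁ hr (by positivity)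
  have hSM₀ : S = ∑ i ∈ Finset.range M₀, truncRate ε r (h * i) := by
    refine (Finset.sum_subset (Finset.range_mono (le_max_left _ _)) fun i _ hi => ?_).symm
    refine truncRate_eq_zero hr ?_
    have : (M₀ : ℝ) ≤ i := by simpa using hi
    rw [show ε / r = h * M₀ by rw [hh]; field_simp]
    gcongr
  have hrate : rateI ε r - η / 2 ≤ h * S := by
    rw [hSM₀]
    linarith [rateI_le_sum hε₀ hε₁ hr (M := M₀) (by exact_mod_cast hM₀pos)]
  have hκ : κ ≤ h * M := by
    have : κ / h ≤ M := hM₁.trans (by exact_mod_cast le_max_right _ _)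
    rw [div_le_iff₀ hh0] at this
    linarith
  have hlog : Tendsto (fun n : ℕ => Real.log n) atTop atTop :=
    Real.tendsto_log_atTop.comp tendsto_natCast_atTop_atTop
  let X : Polynomial ℝ := Polynomial.X
  let B : Polynomial ℝ := Polynomial.C h * X + 1
  have e1 := hlog.eventually (eventually_polynomial_le_exp
    (2 * B * (Polynomial.C (M : ℝ) * B + 2)) one_pos)
  -- Taken at `(η / 2) ln n`, this bounds the polynomial losses by `exp S * n^(η / 2)`. The constant
  -- `exp S`, with `S ≤ 0`, pays for rounding `h ln n` up to `m`.
  have e2 := (hlog.const_mul_atTop (half_pos hη)).eventually (eventually_polynomial_le_exp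
    ((Polynomial.C (2 * Real.exp 1) * (Polynomial.C (h * (η / 2)⁻¹) * X + 1) ^ 2) ^ M)
    (Real.exp_pos S))
  filter_upwards [e1, e2, hlog.eventually_gt_atTop 0, eventually_gt_atTop 0] with n e1 e2 hL hn
    p₂ p₃ hp₂ hp₃ v
  have hn' : (0 : ℝ) < n := by exact_mod_cast hn
  set L := Real.log n with hLdef
  have hexpL : Real.exp L = n := Real.exp_log hn'
  set m := ⌈h * L⌉₊ with hm
  have hm1 : 0 < m := Nat.ceil_pos.2 (by positivity)
  have hm1' : (0 : ℝ) < m := by exact_mod_cast hm1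
  have hmL : h * L ≤ m := Nat.le_ceil _
  have hmU : (m : ℝ) ≤ h * L + 1 := (Nat.ceil_lt_add_one (by positivity)).le
  simp only [X, B, Polynomial.eval_mul, Polynomial.eval_add, Polynomial.eval_pow, Polynomial.eval_C,
    Polynomial.eval_X, Polynomial.eval_one, Polynomial.eval_ofNat, one_mul, hexpL] at e1 e2
  rw [show h * (η / 2)⁻¹ * (η / 2 * L) = h * L by field_simp, ← Real.exp_add] at e2
  have hbig : 2 * m * (M * m + 2) ≤ n := by
    have : 2 * (m : ℝ) * (M * m + 2) ≤ n := le_trans (by gcongr) e1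
    exact_mod_cast this
  have hden : (2 * Real.exp 1 * (m : ℝ) ^ 2) ^ M ≤ Real.exp (S + η / 2 * L) :=
    le_trans (by gcongr) e2
  refine le_trans ?_ (prod_le_edgeLaw_component (M := M) hε₁ hr hh0 hm1 hL hmL (by nlinarith)
    (by omega) hp₂ hp₃ v ?_)
  · rw [Finset.prod_div_distrib, Finset.prod_const, Finset.card_range, ← Real.exp_sum,
      ← Finset.mul_sum, ← hS, Real.rpow_def_of_pos hn', ← hLdef, le_div_iff₀ (by positivity)]
    calc Real.exp (L * (rateI ε r - η)) * (2 * Real.exp 1 * (m : ℝ) ^ 2) ^ M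
        ≤ Real.exp (L * (rateI ε r - η)) * Real.exp (S + η / 2 * L) := by gcongr
      _ = Real.exp (L * (rateI ε r - η / 2) + S) := by rw [← Real.exp_add]; congr 1; ring
      _ ≤ Real.exp (m * S) := by
        refine Real.exp_le_exp.2 ?_
        have := mul_le_mul_of_nonneg_left hrate hL.le
        have := mul_le_mul_of_nonpos_right hmU hS0
        linarith
  · calc κ * L ≤ h * M * L := by gcongr
      _ = M * (h * L) := by ring
      _ ≤ M * m := by gcongr

end Propagation

theorem mainTheorem4 (ε r : ℝ) (hε₀ : 0 < ε) (hε₁ : ε < 1) (hr : 0 < r) :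
    ∃ δ : ℕ → ℝ, Tendsto δ atTop (𝓝 0) ∧
      ∀ᶠ n : ℕ in atTop, ∀ p₂ p₃ : unitInterval,
        (p₂ : ℝ) = (1 - ε) / n → (p₃ : ℝ) = r / (n * Real.log n) →
        ∀ v : Fin n,
          (n : ℝ) ^ (Propagation.rateI ε r - δ n) ≤
              (Propagation.edgeLaw (Fin n) p₂ p₃).real
                {ω | Propagation.K₀ ε r * Real.log n ≤
                  ((Propagation.component (Propagation.hypergraphOf ω) v).ncard : ℝ)} ∧
            (n : ℝ) ^ (Propagation.rateI ε r - δ n) ≤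
              (Propagation.edgeLaw (Fin n) p₂ p₃).real
                {ω | Propagation.Survives (Propagation.hypergraphOf ω) v
                  (Propagation.K₀ ε r * Real.log n)} := by
  obtain ⟨δ, hδ, h⟩ := Propagation.exists_seq_tendsto_zero
    (P := fun n η => ∀ p₂ p₃ : unitInterval,
      (p₂ : ℝ) = (1 - ε) / n → (p₃ : ℝ) = r / (n * Real.log n) → ∀ v : Fin n,
        (n : ℝ) ^ (Propagation.rateI ε r - η) ≤ (Propagation.edgeLaw (Fin n) p₂ p₃).real
          {ω | Propagation.K₀ ε r * Real.log n ≤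
            ((Propagation.component (Propagation.hypergraphOf ω) v).ncard : ℝ)})
    (fun n a b hab h p₂ p₃ hp₂ hp₃ v => (h p₂ p₃ hp₂ hp₃ v).trans' <|
      Real.rpow_le_rpow_of_exponent_le (Nat.one_le_cast.2 v.pos) (by linarith))
    fun η hη => Propagation.eventually_rpow_le_edgeLaw_component hε₀ hε₁ hr _ hη
  refine ⟨δ, hδ, ?_⟩
  filter_upwards [h] with n h p₂ p₃ hp₂ hp₃ v
  have := h p₂ p₃ hp₂ hp₃ v
  exact ⟨this, this.trans (Propagation.edgeLaw_component_le_survives p₂ p₃ v _)⟩
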